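/- Let $q\ge 2$, let $\alpha_{\infty,1},\dots,\alpha_{\infty,q}\in\mathbb R$ be non-zero and pairwise distinct with $\sum_{k=1}^q\alpha_{\infty,k}^2=1$, and let $\nu$ be a probability measure on $\mathbb R$ with finite moments of every order, mean $0$, variance $1$, and cumulants $\kappa_r(\nu)\ne 0$ for $2\le r\le q+1$. Here the $r$-th cumulant of a law, or of a random variable having that law, with characteristic function $\varphi$ is $\kappa_r=(-i)^r\frac{d^r}{dt^r}\log\varphi(t)\big|_{t=0}$. For laws $\mu,\mu'$ on $\mathbb R$ let $W_2(\mu,\mu')=\inf_\pi\big(\int|x-y|^2\,d\pi(x,y)\big)^{1/2}$, the infimum being over all probability measures $\pi$ on $\mathbb R^2$ with marginals $\mu$ and $\mu'$; for random variables, $W_2(X,Y)$ is the distance between their laws. There are constants $C>0$ and $U_\infty>0$, depending only on the target, that is, on $q$, $(\alpha_{\infty,k})_{1\le k\le q}$ and $\nu$, such that the following holds. Let $(W_k)_{k\ge1}$ be independent random variables with common law $\nu$ on a probability space, and put $F_\infty=\sum_{k=1}^q\alpha_{\infty,k}W_k$. For every $n\ge1$ let $(\alpha_{n,k})_{k\ge1}$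 be a real sequence with $\sum_{k\ge1}\alpha_{n,k}^2=1$, and put $F_n=\sum_{k\ge1}\alpha_{n,k}W_k$ (convergence in $L^2$) and $$\Delta(F_n)=\sum_{k\ge1}\alpha_{n,k}^2\prod_{r=1}^q(\alpha_{n,k}-\alpha_{\infty,r})^2.$$ 1. For all $n\ge1$, $$W_2(F_n,F_\infty)\le C\Big(\sqrt{\Delta(F_n)}+\sum_{r=2}^{q+1}|\kappa_r(F_n)-\kappa_r(F_\infty)|\Big).$$ 2. For every $n\ge1$ for which $$\sqrt{\Delta(F_n)}+\sum_{r=2}^{q+1}|\kappa_r(F_n)-\kappa_r(F_\infty)|\le U_\infty,\qquad(\ast)$$ one has $W_2(F_n,F_\infty)\le C\sqrt{\Delta(F_n)}$. 3. In particular, if $\Delta(F_n)\to0$ and $\kappa_r(F_n)\to\kappa_r(F_\infty)$ for all $r=2,\dots,q+1$, then for all sufficiently large $n$ both $(\ast)$ and $W_2(F_n,F_\infty)\le C\sqrt{\Delta(F_n)}$ hold, and $F_n$ converges to $F_\infty$ in distribution. -/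

import Mathlib

open MeasureTheory ProbabilityTheory Filter Topology
open scoped ENNReal

noncomputable section

/-- The `r`-th cumulant of a law `ν` on `ℝ`: `(-i)^r` times the `r`-th derivative at `0` of the
logarithm of the characteristic function. The principal branch of the logarithm is smooth near
`charFun ν 0 = 1`; when `ν` has a finite moment of order `r` this number is real, and the real part
only changes its type. -/
def cumulant (r : ℕ) (ν : Measure ℝ) : ℝ :=
  ((-Complex.I) ^ r * iteratedDeriv r (fun t : ℝ => Complex.log (charFun ν t)) 0).re

/-- The Wasserstein distance of order `p` between two laws on `ℝ`: the infimum of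
`(∫ |x - y| ^ p dπ(x, y)) ^ (1 / p)` over all measures `π` on `ℝ × ℝ` with marginals `μ` and `ν`
(such a `π` is a probability measure as soon as `μ` is). It takes values in `[0, ∞]`, so that
an upper bound for it includes the existence of a coupling of finite cost. -/
def wassersteinDist (p : ℝ) (μ ν : Measure ℝ) : ℝ≥0∞ :=
  ⨅ π ∈ {π : Measure (ℝ × ℝ) | π.map Prod.fst = μ ∧ π.map Prod.snd = ν},
    (∫⁻ z, ENNReal.ofReal |z.1 - z.2| ^ p ∂π) ^ (1 / p)

/-- `X = ∑ₖ c k * W k`: the random variable `X` is square integrable and is the limit in `L²(P)` of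
the partial sums of the series. -/
def IsL2Series {Ω : Type*} [MeasurableSpace Ω] (P : Measure Ω) (c : ℕ → ℝ) (W : ℕ → Ω → ℝ)
    (X : Ω → ℝ) : Prop :=
  MemLp X 2 P ∧
    Tendsto (fun N : ℕ => eLpNorm (fun ω => X ω - ∑ k ∈ Finset.range N, c k * W k ω) 2 P)
      atTop (𝓝 0)

/-- The target `F_∞ = ∑_{k < q} a k * W k`. -/
def targetSum {Ω : Type*} {q : ℕ} (a : Fin q → ℝ) (W : ℕ → Ω → ℝ) (ω : Ω) : ℝ :=
  ∑ k : Fin q, a k * W k ω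

/-- `Δ = ∑ₖ (c k)² ∏ᵣ (c k - a r)²` for an approximating sum with coefficients `c` and a target
with coefficients `a`. -/
def steinDelta {q : ℕ} (a : Fin q → ℝ) (c : ℕ → ℝ) : ℝ :=
  ∑' k : ℕ, c k ^ 2 * ∏ r : Fin q, (c k - a r) ^ 2

/-- `∑_{r=2}^{q+1} |κ_r(μ) - κ_r(ν)|`. -/
def cumulantGap (q : ℕ) (μ ν : Measure ℝ) : ℝ :=
  ∑ r ∈ Finset.Icc 2 (q + 1), |cumulant r μ - cumulant r ν|

end

/-! The summand of `steinDelta a c` is the product of the squared distances from `c k` to the points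
of the finite set `{0} ∪ {a r}`, so up to a constant it dominates the squared distance to the
nearest of them (`exists_nearest_point`). Rounding every `c k` to this set therefore gives `c'` with
`‖c - c'‖₂ ≤ K √Δ`.

The cumulants decide how often each value occurs. By `cumulant_map_of_isL2Series` the cumulant gap
is a weighted `ℓ¹` distance between power sums of orders `2` to `q + 1`, and Cauchy–Schwarz shows
that rounding moves these by `O(√Δ)`. The number of `k` with `c' k = a s` is a linear combination of
those power sums (`exists_dual_powers`); being an integer within less than `1` of `1`, it equals
`1`. So `c'` is a rearrangement of `a` padded with zeros (`exists_matching`).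

As the `W k` are i.i.d., `∑ c' k * W k` has the law of the target, and its `L²` distance to `F n` is
at most `K √Δ`: this coupling gives the second claim. When the hypothesis `(∗)` fails, the trivial
bound `2` suffices for the first. The same copy, compared through characteristic functions, gives
convergence in distribution. -/

/-! ### Rounding to a finite set and Lagrange interpolation -/

/-- A finite set of reals admits a nearest-point map for which the squared distance to the set is
controlled by the product of the squared distances to its points. -/
lemma exists_nearest_point (S : Finset ℝ) (hS : S.Nonempty) :
    ∃ near : ℝ → ℝ, ∃ δ : ℝ, 0 < δ ∧ ∀ x, near x ∈ S ∧ (∀ s ∈ S, |x - near x| ≤ |x - s|) ∧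
      δ * (x - near x) ^ 2 ≤ ∏ s ∈ S, (x - s) ^ 2 := by
  have h : ∀ x : ℝ, ∃ y ∈ S, ∀ s ∈ S, |x - y| ≤ |x - s| := fun x =>
    S.exists_min_image (fun s => |x - s|) hS
  choose near hmem hmin using h
  obtain ⟨d, hd, hdS⟩ : ∃ d : ℝ, 0 < d ∧ ∀ s ∈ S, ∀ t ∈ S, s ≠ t → d ≤ |s - t| := by
    by_cases hne : S.offDiag.Nonempty
    · obtain ⟨p, hp, hpmin⟩ := S.offDiag.exists_min_image (fun p => |p.1 - p.2|) hne
      rw [Finset.mem_offDiag] at hp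
      exact ⟨|p.1 - p.2|, abs_pos.2 (sub_ne_zero.2 hp.2.2), fun s hs t ht hst =>
        hpmin (s, t) (Finset.mem_offDiag.2 ⟨hs, ht, hst⟩)⟩
    · refine ⟨1, one_pos, fun s hs t ht hst => absurd ?_ hne⟩
      exact ⟨(s, t), Finset.mem_offDiag.2 ⟨hs, ht, hst⟩⟩
  -- As `d` bounds the gaps of `S` from below, every point other than the nearest one is at distance
  -- at least `d / 2` from `x`; these `S.card - 1` factors give the constant.
  refine ⟨near, ((d / 2) ^ 2) ^ (S.card - 1), by positivity, fun x => ⟨hmem x, hmin x, ?_⟩⟩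
  rw [← Finset.prod_erase_mul S _ (hmem x), ← Finset.card_erase_of_mem (hmem x),
    ← Finset.prod_const]
  refine mul_le_mul_of_nonneg_right (Finset.prod_le_prod (fun _ _ => by positivity) ?_)
    (sq_nonneg _)
  intro s hs
  obtain ⟨hs1, hs2⟩ := Finset.mem_erase.1 hs
  have h1 := hdS s hs2 _ (hmem x) hs1
  have h2 := hmin x s hs2
  have h3 : |s - near x| ≤ |x - s| + |x - near x| := by
    rw [abs_sub_comm x s]; exact abs_sub_le _ _ _
  rw [← sq_abs (x - s)]
  exact pow_le_pow_left₀ (by positivity) (by linarith) 2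

/-- The conditions `∑ j, b s j * a t ^ (j + 2) = δ_{st}` can be solved for `b` when the nodes `a t`
are distinct and non-zero. -/
lemma exists_dual_powers {q : ℕ} (a : Fin q → ℝ) (ha_ne : ∀ k, a k ≠ 0)
    (ha_inj : Function.Injective a) :
    ∃ b : Fin q → ℕ → ℝ, ∀ s t, ∑ j ∈ Finset.range q, b s j * a t ^ (j + 2) =
      if t = s then 1 else 0 := by
  -- The coefficients of `x² L_s(x) / a s²`, with `L_s` the Lagrange basis polynomial: only the
  -- powers `2` to `q + 1` occur.
  refine ⟨fun s j => (Lagrange.basis Finset.univ a s).coeff j / a s ^ 2, fun s t => ?_⟩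
  have hdeg : (Lagrange.basis Finset.univ a s).natDegree < q := by
    have hs := s.pos
    have := Lagrange.degree_basis (s := Finset.univ) (v := a) ha_inj.injOn (Finset.mem_univ s)
    rw [Polynomial.natDegree_eq_of_degree_eq_some this]
    simp; omega
  have hev := Polynomial.eval_eq_sum_range' hdeg (a t)
  have : ∑ j ∈ Finset.range q, (Lagrange.basis Finset.univ a s).coeff j / a s ^ 2 * a t ^ (j + 2) =
      (Lagrange.basis Finset.univ a s).eval (a t) * (a t ^ 2 / a s ^ 2) := by
    rw [hev, Finset.sum_mul]
    exact Finset.sum_congr rfl fun j _ => by ring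
  rw [this]
  split_ifs with h
  · subst h
    rw [Lagrange.eval_basis_self ha_inj.injOn (Finset.mem_univ t),
      div_self (pow_ne_zero 2 (ha_ne t)), one_mul]
  · rw [Lagrange.eval_basis_of_ne (Ne.symm h) (Finset.mem_univ t), zero_mul]

/-! ### Power sums of square-summable sequences -/

/-- The factor `|x|` is kept beside `|x - y|` so that the bound can be summed over `k` by
Cauchy–Schwarz; `|x - y|` alone need not be summable. -/
lemma abs_pow_add_two_sub_pow_add_two_le (n : ℕ) {x y : ℝ} (hx : |x| ≤ 1) (hy : |y| ≤ 2 * |x|) :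
    |x ^ (n + 2) - y ^ (n + 2)| ≤ 3 * (n + 1) * 2 ^ n * (|x - y| * |x|) := by
  have hy2 : |y| ≤ 2 := by linarith
  induction n with
  | zero =>
    have : x ^ (0 + 2) - y ^ (0 + 2) = (x - y) * (x + y) := by ring
    rw [this, abs_mul]
    have h := abs_add_le x y
    have := mul_le_mul_of_nonneg_left (h.trans (by linarith : _ ≤ 3 * |x|)) (abs_nonneg (x - y))
    norm_num
    linarith
  | succ n ih =>
    have e : x ^ (n + 1 + 2) - y ^ (n + 1 + 2) =
      x * (x ^ (n + 2) - y ^ (n + 2)) + (x - y) * (y ^ (n + 1) * y) := by ring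
    rw [e]
    refine (abs_add_le _ _).trans ?_
    rw [abs_mul, abs_mul, abs_mul, abs_pow]
    have h1 : |x| * |x ^ (n + 2) - y ^ (n + 2)| ≤ 1 * (3 * (n + 1) * 2 ^ n * (|x - y| * |x|)) :=
      mul_le_mul hx ih (abs_nonneg _) zero_le_one
    have h2 : |y| ^ (n + 1) * |y| ≤ 2 ^ (n + 1) * (2 * |x|) :=
      mul_le_mul (pow_le_pow_left₀ (abs_nonneg _) hy2 _) hy (abs_nonneg _) (by positivity)
    have h3 := mul_le_mul_of_nonneg_left h2 (abs_nonneg (x - y))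
    have h4 : 0 ≤ 2 ^ n * (|x - y| * |x|) := by positivity
    have h5 : 0 ≤ (n : ℝ) * (2 ^ n * (|x - y| * |x|)) := by positivity
    have h6 : |x - y| * (2 ^ (n + 1) * (2 * |x|)) = 4 * (2 ^ n * (|x - y| * |x|)) := by ring
    have h7 : 3 * ((n : ℝ) + 1 + 1) * 2 ^ (n + 1) * (|x - y| * |x|) =
      6 * (n * (2 ^ n * (|x - y| * |x|))) + 12 * (2 ^ n * (|x - y| * |x|)) := by ring
    push_cast
    rw [h7]
    linarith

lemma abs_le_one_of_hasSum_sq {c : ℕ → ℝ} (hc : HasSum (fun k => c k ^ 2) 1) (k : ℕ) :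
    |c k| ≤ 1 := by
  have := le_hasSum hc k fun j _ => sq_nonneg (c j)
  exact (sq_le_one_iff_abs_le_one _).1 this

lemma abs_pow_add_two_le_sq {x : ℝ} (hx : |x| ≤ 1) (j : ℕ) : |x ^ (j + 2)| ≤ x ^ 2 := by
  rw [abs_pow, pow_add, sq_abs]
  exact mul_le_of_le_one_left (sq_nonneg _) (pow_le_one₀ (abs_nonneg _) hx)

lemma summable_pow_add_two {c : ℕ → ℝ} (hc : HasSum (fun k => c k ^ 2) 1) (j : ℕ) :
    Summable fun k => c k ^ (j + 2) :=
  .of_norm_bounded hc.summable fun k => abs_pow_add_two_le_sq (abs_le_one_of_hasSum_sq hc k) j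

lemma summable_steinDelta {q : ℕ} (a : Fin q → ℝ) {c : ℕ → ℝ}
    (hc : HasSum (fun k => c k ^ 2) 1) :
    Summable fun k => c k ^ 2 * ∏ r, (c k - a r) ^ 2 := by
  refine .of_nonneg_of_le (fun k => by positivity) (fun k => ?_)
    (hc.summable.mul_right (∏ r, (1 + |a r|) ^ 2))
  refine mul_le_mul_of_nonneg_left (Finset.prod_le_prod (fun _ _ => sq_nonneg _) fun r _ => ?_)
    (sq_nonneg _)
  rw [← sq_abs]
  refine pow_le_pow_left₀ (abs_nonneg _) ((abs_sub _ _).trans ?_) 2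
  linarith [abs_le_one_of_hasSum_sq hc k]

lemma tsum_abs_mul_abs_le {u v : ℕ → ℝ} (hu : Summable fun k => u k ^ 2)
    (hv : HasSum (fun k => v k ^ 2) 1) :
    Summable (fun k => |u k| * |v k|) ∧ ∑' k, |u k| * |v k| ≤ √(∑' k, u k ^ 2) := by
  have h := Real.summable_and_inner_le_Lp_mul_Lq_tsum_of_nonneg Real.HolderConjugate.two_two
    (f := fun k => |u k|) (g := fun k => |v k|) (fun k => abs_nonneg _) (fun k => abs_nonneg _)
    (by simpa using hu) (by simpa using hv.summable)
  refine ⟨h.1, h.2.trans_eq ?_⟩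
  simp [hv.tsum_eq, Real.sqrt_eq_rpow]

/-- A `0`-`1` valued family with sum at distance less than `1` from `1` takes the value `1` exactly
once. -/
lemma existsUnique_of_abs_tsum_indicator_sub_one_lt {p : ℕ → Prop} [DecidablePred p]
    (hs : Summable fun k => if p k then (1 : ℝ) else 0)
    (h : |∑' k, (if p k then (1 : ℝ) else 0) - 1| < 1) : ∃! k, p k := by
  have h0 : ∀ k, 0 ≤ if p k then (1 : ℝ) else 0 := fun k => by split_ifs <;> norm_num
  rw [abs_lt] at h
  have hex : ∃ k, p k := by
    by_contra! hne
    simp [hne] at h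
  obtain ⟨k, hk⟩ := hex
  refine ⟨k, hk, fun l hl => ?_⟩
  by_contra hlk
  have := hs.sum_le_tsum {l, k} fun i _ => h0 i
  rw [Finset.sum_pair hlk, if_pos hk, if_pos hl] at this
  linarith

/-! ### Matching the coefficients -/

/-- If the weighted power sums of `c` are close to those of `a` and `steinDelta a c` is small, then
`c` is, up to a permutation and an error controlled by `steinDelta a c`, the family `a` extended by
zeros. -/
lemma exists_matching {q : ℕ} (a : Fin q → ℝ) (ha_ne : ∀ k, a k ≠ 0)
    (ha_inj : Function.Injective a) (w : ℕ → ℝ) (hw : ∀ j < q, 0 < w j) :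
    ∃ K : ℝ, 0 < K ∧ ∃ U : ℝ, 0 < U ∧ ∀ c : ℕ → ℝ, HasSum (fun k => c k ^ 2) 1 →
      √(steinDelta a c) + ∑ j ∈ Finset.range q,
        w j * |∑' k, c k ^ (j + 2) - ∑ t, a t ^ (j + 2)| ≤ U →
      ∃ σ : Fin q → ℕ, ∃ c' : ℕ → ℝ, Function.Injective σ ∧ (∀ s, c' (σ s) = a s) ∧
        (∀ k, k ∉ Set.range σ → c' k = 0) ∧ ∀ N,
        √(∑ k ∈ Finset.range N, (c k - c' k) ^ 2) ≤ K * √(steinDelta a c) := by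
  classical
  obtain ⟨near, δ, hδ, hnear⟩ := exists_nearest_point (insert 0 (Finset.univ.image a)) (by simp)
  obtain ⟨b, hb⟩ := exists_dual_powers a ha_ne ha_inj
  have hprod : ∀ x : ℝ, ∏ s ∈ insert 0 (Finset.univ.image a), (x - s) ^ 2 =
      x ^ 2 * ∏ r, (x - a r) ^ 2 := fun x => by
    rw [Finset.prod_insert (by simpa using ha_ne), Finset.prod_image ha_inj.injOn, sub_zero]
  -- Zero belongs to the rounding set, so rounding moves `x` by at most `|x|`.
  have hn0 : ∀ x, |x - near x| ≤ |x| := fun x => by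
    simpa using (hnear x).2.1 0 (by simp)
  have hn2 : ∀ x, |near x| ≤ 2 * |x| := fun x => by
    have := abs_sub_abs_le_abs_sub (near x) x
    rw [abs_sub_comm] at this
    linarith [hn0 x]
  set K : ℝ := √(1 / δ) with hK
  have hKpos : 0 < K := Real.sqrt_pos.2 (by positivity)
  set A : ℝ := ∑ s, ∑ j ∈ Finset.range q, |b s j| / w j with hA
  set B : ℝ := ∑ s, ∑ j ∈ Finset.range q, |b s j| * (3 * (j + 1) * 2 ^ j) with hB
  have hA0 : 0 ≤ A := Finset.sum_nonneg fun s _ => Finset.sum_nonneg fun j hj =>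
    div_nonneg (abs_nonneg _) (hw j (Finset.mem_range.1 hj)).le
  have hB0 : 0 ≤ B := Finset.sum_nonneg fun s _ => Finset.sum_nonneg fun j hj => by positivity
  -- Each count will deviate from `1` by at most `A * G + B * K * √Δ`; the extra `1` makes the
  -- deviation strictly less than `1`.
  refine ⟨K, hKpos, 1 / (A + B * K + 1), by positivity, fun c hc hU => ?_⟩
  set G := ∑ j ∈ Finset.range q, w j * |∑' k, c k ^ (j + 2) - ∑ t, a t ^ (j + 2)| with hG
  have hG0 : 0 ≤ G := Finset.sum_nonneg fun j hj =>
    mul_nonneg (hw j (Finset.mem_range.1 hj)).le (abs_nonneg _)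
  have hc1 := abs_le_one_of_hasSum_sq hc
  have hdle : ∀ k, (c k - near (c k)) ^ 2 ≤ 1 / δ * (c k ^ 2 * ∏ r, (c k - a r) ^ 2) := fun k => by
    rw [← hprod, one_div, ← div_eq_inv_mul, le_div_iff₀ hδ, mul_comm]
    exact (hnear (c k)).2.2
  have hΔs := (summable_steinDelta a hc).mul_left (1 / δ)
  have hds : Summable fun k => (c k - near (c k)) ^ 2 :=
    .of_nonneg_of_le (fun _ => sq_nonneg _) hdle hΔs
  have hD : √(∑' k, (c k - near (c k)) ^ 2) ≤ K * √(steinDelta a c) := by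
    rw [hK, ← Real.sqrt_mul (by positivity)]
    refine Real.sqrt_le_sqrt ((hds.tsum_le_tsum hdle hΔs).trans_eq ?_)
    rw [tsum_mul_left, steinDelta]
  obtain ⟨hCSs, hCS⟩ := tsum_abs_mul_abs_le hds hc
  -- The interpolating polynomial also vanishes at `0`, so on the rounding set it is the indicator
  -- of `a s`.
  have hind : ∀ s k, ∑ j ∈ Finset.range q, b s j * near (c k) ^ (j + 2) =
      if near (c k) = a s then 1 else 0 := fun s k => by
    have h := (hnear (c k)).1
    rw [Finset.mem_insert, Finset.mem_image] at h
    rcases h with h | ⟨t, -, h⟩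
    · simp [h, (ha_ne s).symm]
    · rw [← h, hb]
      simp [ha_inj.eq_iff]
  have hpow : ∀ j k : ℕ, |c k ^ (j + 2) - near (c k) ^ (j + 2)| ≤
      3 * (j + 1) * 2 ^ j * (|c k - near (c k)| * |c k|) := fun j k =>
    abs_pow_add_two_sub_pow_add_two_le j (hc1 k) (hn2 _)
  have hps := summable_pow_add_two hc
  have hdiffs : ∀ j, Summable fun k => c k ^ (j + 2) - near (c k) ^ (j + 2) := fun j =>
    .of_norm_bounded (hCSs.mul_left _) (hpow j)
  have hnps : ∀ j, Summable fun k => near (c k) ^ (j + 2) := fun j => by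
    simpa using (hps j).sub (hdiffs j)
  have hdiff : ∀ j : ℕ, |∑' k, c k ^ (j + 2) - ∑' k, near (c k) ^ (j + 2)| ≤
      3 * (j + 1) * 2 ^ j * (K * √(steinDelta a c)) := fun j => by
    rw [← (hps j).tsum_sub (hnps j)]
    refine (norm_tsum_le_tsum_norm (hdiffs j).norm).trans ?_
    refine ((hdiffs j).norm.tsum_le_tsum (hpow j) (hCSs.mul_left _)).trans ?_
    rw [tsum_mul_left]
    exact mul_le_mul_of_nonneg_left (hCS.trans hD) (by positivity)
  have huniq : ∀ s, ∃! k, near (c k) = a s := fun s => by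
    have hsum : Summable fun k => if near (c k) = a s then (1 : ℝ) else 0 := by
      simp_rw [← hind s]
      exact summable_sum fun j _ => (hnps j).mul_left _
    refine existsUnique_of_abs_tsum_indicator_sub_one_lt hsum ?_
    have h1 : ∑ j ∈ Finset.range q, b s j * ∑ t, a t ^ (j + 2) = 1 := by
      simp_rw [Finset.mul_sum]
      rw [Finset.sum_comm]
      simp [hb]
    -- Two sources of error: the power sums of `c` against those of `a`, and the effect of rounding.
    have h2 : ∑' k, (if near (c k) = a s then (1 : ℝ) else 0) - 1 =
        ∑ j ∈ Finset.range q, (b s j * (∑' k, c k ^ (j + 2) - ∑ t, a t ^ (j + 2)) -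
          b s j * (∑' k, c k ^ (j + 2) - ∑' k, near (c k) ^ (j + 2))) := by
      simp_rw [← hind s]
      rw [Summable.tsum_finsetSum fun j _ => (hnps j).mul_left _, ← h1, ← Finset.sum_sub_distrib]
      refine Finset.sum_congr rfl fun j _ => ?_
      rw [tsum_mul_left]
      ring
    have hT : ∀ j ∈ Finset.range q, |b s j * (∑' k, c k ^ (j + 2) - ∑ t, a t ^ (j + 2)) -
          b s j * (∑' k, c k ^ (j + 2) - ∑' k, near (c k) ^ (j + 2))| ≤
        |b s j| / w j * G + |b s j| * (3 * (j + 1) * 2 ^ j) * (K * √(steinDelta a c)) := by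
      intro j hj
      refine (abs_sub _ _).trans ?_
      rw [abs_mul, abs_mul]
      have hwj := hw j (Finset.mem_range.1 hj)
      refine add_le_add ?_ ?_
      · rw [div_mul_eq_mul_div, mul_div_assoc]
        refine mul_le_mul_of_nonneg_left ?_ (abs_nonneg _)
        rw [le_div_iff₀ hwj, mul_comm]
        exact Finset.single_le_sum (f := fun j => w j * |∑' k, c k ^ (j + 2) - ∑ t, a t ^ (j + 2)|)
          (fun i hi => mul_nonneg (hw i (Finset.mem_range.1 hi)).le (abs_nonneg _)) hj
      · rw [mul_assoc]
        exact mul_le_mul_of_nonneg_left (hdiff j) (abs_nonneg _)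
    have hAs : ∑ j ∈ Finset.range q, |b s j| / w j ≤ A :=
      Finset.single_le_sum (f := fun s => ∑ j ∈ Finset.range q, |b s j| / w j)
        (fun s _ => Finset.sum_nonneg fun j hj =>
          div_nonneg (abs_nonneg _) (hw j (Finset.mem_range.1 hj)).le) (Finset.mem_univ s)
    have hBs : ∑ j ∈ Finset.range q, |b s j| * (3 * (j + 1) * 2 ^ j) ≤ B :=
      Finset.single_le_sum (f := fun s => ∑ j ∈ Finset.range q, |b s j| * (3 * (j + 1) * 2 ^ j))
        (fun s _ => Finset.sum_nonneg fun j hj => by positivity) (Finset.mem_univ s)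
    rw [h2]
    refine (Finset.abs_sum_le_sum_abs _ _).trans_lt ((Finset.sum_le_sum hT).trans_lt ?_)
    rw [Finset.sum_add_distrib, ← Finset.sum_mul, ← Finset.sum_mul]
    have hden : 0 < A + B * K + 1 := by positivity
    rw [le_div_iff₀ hden] at hU
    have hΔ0 := Real.sqrt_nonneg (steinDelta a c)
    have g1 := mul_le_mul_of_nonneg_right hAs hG0
    have g2 := mul_le_mul_of_nonneg_right hBs (by positivity : 0 ≤ K * √(steinDelta a c))
    have g3 : 0 ≤ A * √(steinDelta a c) := by positivity
    have g4 : 0 ≤ B * K * G := by positivity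
    -- Strictness comes from `√Δ + G > 0`; if this sum is zero, so is the deviation.
    rcases (add_nonneg hΔ0 hG0).eq_or_lt with h0 | h0
    · have hG' : G = 0 := by linarith
      have hΔ' : √(steinDelta a c) = 0 := by linarith
      rw [hG', hΔ']
      norm_num
    · nlinarith
  choose σ hσ hσu using huniq
  refine ⟨σ, fun k => near (c k), fun s t hst => ha_inj ?_, hσ, fun k hk => ?_, fun N => ?_⟩
  · rw [← hσ s, hst, hσ t]
  · have h := (hnear (c k)).1
    rw [Finset.mem_insert, Finset.mem_image] at h
    rcases h with h | ⟨t, -, h⟩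
    · exact h
    · exact absurd ⟨t, (hσu t k h.symm).symm⟩ hk
  · exact (Real.sqrt_le_sqrt (hds.sum_le_tsum _ fun _ _ => sq_nonneg _)).trans hD

/-! ### Termwise differentiation of `∑ f (c k * t)` -/

lemma ContDiffOn.hasDerivAt_iteratedDeriv {f : ℝ → ℂ} {U : Set ℝ} (hU : IsOpen U)
    (hf : ContDiffOn ℝ (⊤ : ℕ∞) f U) (j : ℕ) {x : ℝ} (hx : x ∈ U) :
    HasDerivAt (iteratedDeriv j f) (iteratedDeriv (j + 1) f x) x := by
  rw [iteratedDeriv_succ, hasDerivAt_deriv_iff]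
  have h1 := (hf.differentiableOn_iteratedDerivWithin (m := j)
    (by exact_mod_cast ENat.natCast_lt_top j) hU.uniqueDiffOn).differentiableAt (hU.mem_nhds hx)
  refine h1.congr_of_eventuallyEq ?_
  filter_upwards [hU.mem_nhds hx] with y hy
  exact (iteratedDerivWithin_of_isOpen hU hy).symm

lemma ContDiffOn.exists_bound_iteratedDeriv {f : ℝ → ℂ} {U : Set ℝ} (hU : IsOpen U)
    (hf : ContDiffOn ℝ (⊤ : ℕ∞) f U) {δ : ℝ} (hδU : Set.Icc (-δ) δ ⊆ U) (j : ℕ) :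
    ∃ M : ℝ, 0 ≤ M ∧ ∀ x ∈ Set.Icc (-δ) δ, ‖iteratedDeriv j f x‖ ≤ M := by
  obtain ⟨M, hM⟩ := isCompact_Icc.exists_bound_of_continuousOn (f := iteratedDeriv j f)
    (s := Set.Icc (-δ) δ)
    fun x hx => (hf.hasDerivAt_iteratedDeriv hU j (hδU hx)).continuousAt.continuousWithinAt
  exact ⟨max M 0, le_max_right _ _, fun x hx => (hM x hx).trans (le_max_left _ _)⟩

/-- Termwise differentiation of `∑ f (c k * t)` when `f` vanishes to second order at `0`. -/
lemma hasDerivAt_tsum_pow_smul_iteratedDeriv {f : ℝ → ℂ} {U : Set ℝ} (hU : IsOpen U)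
    (hf : ContDiffOn ℝ (⊤ : ℕ∞) f U) {δ : ℝ} (hδ : 0 < δ) (hδU : Set.Icc (-δ) δ ⊆ U)
    (h0 : f 0 = 0) (h1 : deriv f 0 = 0) {c : ℕ → ℝ} (hc : HasSum (fun k => c k ^ 2) 1)
    (j : ℕ) {t : ℝ} (ht : t ∈ Set.Ioo (-δ) δ) :
    HasDerivAt (fun t => ∑' k, (c k ^ j : ℂ) * iteratedDeriv j f (c k * t))
      (∑' k, (c k ^ (j + 1) : ℂ) * iteratedDeriv (j + 1) f (c k * t)) t := by
  have hc1 := abs_le_one_of_hasSum_sq hc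
  have hmem : ∀ k, ∀ y ∈ Set.Ioo (-δ) δ, c k * y ∈ Set.Icc (-δ) δ := fun k y hy => by
    rw [Set.mem_Icc, ← abs_le, abs_mul]
    exact (mul_le_of_le_one_left (abs_nonneg _) (hc1 k)).trans (abs_lt.2 hy).le
  obtain ⟨M, hM0, hM⟩ := hf.exists_bound_iteratedDeriv hU hδU (j + 1)
  obtain ⟨M₂, hM20, hM2⟩ := hf.exists_bound_iteratedDeriv hU hδU 2
  -- One majorant serves all orders. For `j ≥ 1` the power of `c k` is already at least two; for `j
  -- = 0` the second factor `c k` comes from `deriv f 0 = 0` and the mean value inequality, whence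
  -- `M₂ * δ`.
  refine hasDerivAt_tsum_of_isPreconnected (t := Set.Ioo (-δ) δ) (y₀ := 0)
    (g := fun k t => (c k ^ j : ℂ) * iteratedDeriv j f (c k * t))
    (g' := fun k t => (c k ^ (j + 1) : ℂ) * iteratedDeriv (j + 1) f (c k * t))
    (u := fun k => (M + M₂ * δ) * c k ^ 2)
    (hc.summable.mul_left _) isOpen_Ioo isPreconnected_Ioo (fun k y hy => ?_) (fun k y hy => ?_)
    (by simpa using hδ) ?_ ht
  · have h := (hf.hasDerivAt_iteratedDeriv hU j (hδU (hmem k y hy))).scomp y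
      ((hasDerivAt_id y).const_mul (c k))
    have h' := h.const_mul (c k ^ j : ℂ)
    refine h'.congr_deriv ?_
    simp only [mul_one, Complex.real_smul]
    ring
  · rcases j with _ | j
    · have hmvt : ‖iteratedDeriv 1 f (c k * y) - iteratedDeriv 1 f 0‖ ≤ M₂ * ‖c k * y - 0‖ :=
        (convex_Icc (-δ) δ).norm_image_sub_le_of_norm_hasDerivWithin_le (f' := iteratedDeriv 2 f)
          (fun x hx => (hf.hasDerivAt_iteratedDeriv hU 1 (hδU hx)).hasDerivWithinAt) hM2
          (by simpa using hδ.le) (hmem k y hy)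
      have hyδ : |y| ≤ δ := (abs_lt.2 hy).le
      rw [iteratedDeriv_one, h1, sub_zero, sub_zero, Real.norm_eq_abs, abs_mul] at hmvt
      rw [norm_mul, zero_add, pow_one, Complex.norm_real, Real.norm_eq_abs, iteratedDeriv_one]
      calc |c k| * ‖deriv f (c k * y)‖
          ≤ |c k| * (M₂ * (|c k| * δ)) := by gcongr; exact hmvt.trans (by gcongr)
        _ = M₂ * δ * c k ^ 2 := by rw [← sq_abs]; ring
        _ ≤ _ := by
          have : 0 ≤ M * c k ^ 2 := by positivity
          linarith
    · rw [norm_mul, ← Complex.ofReal_pow, Complex.norm_real, Real.norm_eq_abs]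
      calc |c k ^ (j + 2)| * ‖iteratedDeriv (j + 1 + 1) f (c k * y)‖
          ≤ c k ^ 2 * M := mul_le_mul (abs_pow_add_two_le_sq (hc1 k) j) (hM _ (hmem k y hy))
            (norm_nonneg _) (sq_nonneg _)
        _ ≤ _ := by
          have : 0 ≤ M₂ * δ * c k ^ 2 := by positivity
          linarith
  · rcases j with _ | _ | j
    · simp [h0]
    · simp [h1]
    · simp only [mul_zero]
      refine Summable.mul_right _ ?_
      exact_mod_cast Complex.summable_ofReal.2 (summable_pow_add_two hc j)

lemma iteratedDeriv_tsum_comp_mul {f : ℝ → ℂ} {U : Set ℝ} (hU : IsOpen U)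
    (hf : ContDiffOn ℝ (⊤ : ℕ∞) f U) {δ : ℝ} (hδ : 0 < δ) (hδU : Set.Icc (-δ) δ ⊆ U)
    (h0 : f 0 = 0) (h1 : deriv f 0 = 0) {c : ℕ → ℝ} (hc : HasSum (fun k => c k ^ 2) 1)
    (j : ℕ) {t : ℝ} (ht : t ∈ Set.Ioo (-δ) δ) :
    iteratedDeriv j (fun t => ∑' k, f (c k * t)) t =
      ∑' k, (c k ^ j : ℂ) * iteratedDeriv j f (c k * t) := by
  induction j generalizing t with
  | zero => simp
  | succ j ih =>
    rw [iteratedDeriv_succ]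
    have : iteratedDeriv j (fun t => ∑' k, f (c k * t)) =ᶠ[𝓝 t]
        fun t => ∑' k, (c k ^ j : ℂ) * iteratedDeriv j f (c k * t) := by
      filter_upwards [isOpen_Ioo.mem_nhds ht] with y hy using ih hy
    rw [this.deriv_eq]
    exact (hasDerivAt_tsum_pow_smul_iteratedDeriv hU hf hδ hδU h0 h1 hc j ht).deriv

/-- Two mean value inequalities give `‖f x‖ ≤ M x²`, which is summable along `c k * t`. -/
lemma summable_comp_mul {f : ℝ → ℂ} {U : Set ℝ} (hU : IsOpen U)
    (hf : ContDiffOn ℝ (⊤ : ℕ∞) f U) {δ : ℝ} (hδU : Set.Icc (-δ) δ ⊆ U)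
    (h0 : f 0 = 0) (h1 : deriv f 0 = 0) {c : ℕ → ℝ} (hc : HasSum (fun k => c k ^ 2) 1)
    {t : ℝ} (ht : t ∈ Set.Ioo (-δ) δ) : Summable fun k => f (c k * t) := by
  have hc1 := abs_le_one_of_hasSum_sq hc
  obtain ⟨M, hM0, hM⟩ := hf.exists_bound_iteratedDeriv hU hδU 2
  have hsub : ∀ {x}, x ∈ Set.Icc (-δ) δ → Set.Icc (-|x|) |x| ⊆ Set.Icc (-δ) δ := fun hx =>
    Set.Icc_subset_Icc (neg_le_neg (abs_le.2 hx)) (abs_le.2 hx)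
  have h1' : ∀ x ∈ Set.Icc (-δ) δ, ‖deriv f x‖ ≤ M * |x| := fun x hx => by
    have := (convex_Icc (-δ) δ).norm_image_sub_le_of_norm_hasDerivWithin_le
      (f := iteratedDeriv 1 f) (f' := iteratedDeriv 2 f) (x := 0)
      (fun y hy => (hf.hasDerivAt_iteratedDeriv hU 1 (hδU hy)).hasDerivWithinAt) hM
      (hsub hx (by simp)) hx
    simpa [iteratedDeriv_one, h1] using this
  have h2 : ∀ x ∈ Set.Icc (-δ) δ, ‖f x‖ ≤ M * |x| * |x| := fun x hx => by
    have := (convex_Icc (-|x|) |x|).norm_image_sub_le_of_norm_hasDerivWithin_le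
      (f := iteratedDeriv 0 f) (f' := iteratedDeriv 1 f) (x := 0) (y := x) (C := M * |x|)
      (fun y hy => (hf.hasDerivAt_iteratedDeriv hU 0 (hδU (hsub hx hy))).hasDerivWithinAt)
      (fun y hy => by
        rw [iteratedDeriv_one]
        exact (h1' y (hsub hx hy)).trans (mul_le_mul_of_nonneg_left (abs_le.2 hy) hM0))
      (by simp) ⟨neg_abs_le x, le_abs_self x⟩
    simpa [h0] using this
  refine .of_norm_bounded (hc.summable.mul_left (M * t ^ 2)) fun k => (h2 _ ?_).trans_eq ?_
  · rw [Set.mem_Icc, ← abs_le, abs_mul]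
    exact (mul_le_of_le_one_left (abs_nonneg _) (hc1 k)).trans (abs_lt.2 ht).le
  · rw [mul_assoc, ← sq, sq_abs]
    ring

/-! ### Characteristic functions and cumulants of the series -/

/-- The map `x ↦ exp (i t x)` is `|t|`-Lipschitz, and the `L¹` norm is at most the `L²` norm on a
probability space. -/
lemma norm_charFun_map_sub_le {Ω : Type*} [MeasurableSpace Ω] {P : Measure Ω}
    [IsProbabilityMeasure P] {X Y : Ω → ℝ} (hX : AEMeasurable X P) (hY : AEMeasurable Y P)
    (hXY : eLpNorm (fun ω => X ω - Y ω) 2 P ≠ ∞) (t : ℝ) :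
    ‖charFun (P.map X) t - charFun (P.map Y) t‖ ≤
      |t| * (eLpNorm (fun ω => X ω - Y ω) 2 P).toReal := by
  have hLp : MemLp (fun ω => X ω - Y ω) 2 P :=
    ⟨(hX.sub hY).aestronglyMeasurable, lt_top_iff_ne_top.2 hXY⟩
  have hint : Integrable (fun ω => X ω - Y ω) P := hLp.integrable (by norm_num)
  have hexp : ∀ {Z : Ω → ℝ}, AEMeasurable Z P →
      Integrable (fun ω => Complex.exp (t * Z ω * Complex.I)) P := fun {Z} hZ => by
    refine .of_bound (by fun_prop) 1 (.of_forall fun ω => ?_)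
    rw [← Complex.ofReal_mul, Complex.norm_exp_ofReal_mul_I]
  rw [charFun_apply_real, charFun_apply_real, integral_map hX (by fun_prop),
    integral_map hY (by fun_prop), ← integral_sub (hexp hX) (hexp hY)]
  calc ‖∫ ω, (Complex.exp (t * X ω * Complex.I) - Complex.exp (t * Y ω * Complex.I)) ∂P‖
      ≤ ∫ ω, |t| * ‖X ω - Y ω‖ ∂P := by
        refine norm_integral_le_of_norm_le (hint.norm.const_mul _) (.of_forall fun ω => ?_)
        have e : Complex.exp (t * X ω * Complex.I) - Complex.exp (t * Y ω * Complex.I) =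
            Complex.exp ((t * Y ω : ℝ) * Complex.I) *
              (Complex.exp (Complex.I * (t * (X ω - Y ω) : ℝ)) - 1) := by
          rw [mul_sub, ← Complex.exp_add, mul_one]
          push_cast
          ring_nf
        rw [e, norm_mul, Complex.norm_exp_ofReal_mul_I, one_mul]
        exact Real.norm_exp_I_mul_ofReal_sub_one_le.trans_eq (by rw [norm_mul, Real.norm_eq_abs])
    _ = |t| * (eLpNorm (fun ω => X ω - Y ω) 1 P).toReal := by
        rw [integral_const_mul, integral_norm_eq_lintegral_enorm hLp.1, eLpNorm_one_eq_lintegral_enorm]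
    _ ≤ _ := by
        gcongr
        exact eLpNorm_le_eLpNorm_of_exponent_le (by norm_num) hLp.1

section Series

variable {Ω : Type*} [MeasurableSpace Ω] {P : Measure Ω} {ν : Measure ℝ} {W : ℕ → Ω → ℝ}

lemma charFun_map_sum_mul (hW : iIndepFun W P) (hlaw : ∀ k, HasLaw (W k) ν P) (c : ℕ → ℝ)
    (N : ℕ) (t : ℝ) :
    charFun (P.map fun ω => ∑ k ∈ Finset.range N, c k * W k ω) t =
      ∏ k ∈ Finset.range N, charFun ν (c k * t) := by
  have hi : iIndepFun (fun k ω => c k * W k ω) P :=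
    hW.comp (fun k x => c k * x) fun k => by fun_prop
  rw [(hi.restrict _).charFun_map_fun_finsetSum_eq_prod
    fun k _ => (hlaw k).aemeasurable.const_mul _, Finset.prod_apply]
  refine Finset.prod_congr rfl fun k _ => ?_
  rw [charFun_map_mul_comp (hlaw k).aemeasurable, (hlaw k).map_eq]

lemma memLp_two_of_hasLaw (hν : MemLp (fun x : ℝ => x) 2 ν) (hlaw : ∀ k, HasLaw (W k) ν P)
    (k : ℕ) : MemLp (W k) 2 P := by
  have h2 : MemLp (fun x : ℝ => x) 2 (P.map (W k)) := by rwa [(hlaw k).map_eq]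
  exact h2.comp_of_map (hlaw k).aemeasurable

/-- Independent copies can be permuted: `∑ a s * W (σ s)` has the law of the target. -/
lemma map_sum_mul_comp_eq (hW : iIndepFun W P) (hlaw : ∀ k, HasLaw (W k) ν P) {q : ℕ}
    (a : Fin q → ℝ) {σ : Fin q → ℕ} (hσ : Function.Injective σ) :
    P.map (fun ω => ∑ s, a s * W (σ s) ω) = P.map (targetSum a W) := by
  have hm : Measurable fun x : Fin q → ℝ => ∑ s, a s * x s := by fun_prop
  have key : ∀ τ : Fin q → ℕ, Function.Injective τ → P.map (fun ω => ∑ s, a s * W (τ s) ω) =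
      (Measure.pi fun _ : Fin q => ν).map fun x => ∑ s, a s * x s := fun τ hτ => by
    have h := (hW.precomp hτ).map_fun_eq_pi_map fun s => (hlaw (τ s)).aemeasurable
    simp_rw [(hlaw _).map_eq] at h
    rw [← h, AEMeasurable.map_map_of_aemeasurable hm.aemeasurable
      (aemeasurable_pi_lambda _ fun s => (hlaw (τ s)).aemeasurable)]
    rfl
  rw [key σ hσ, ← key _ Fin.val_injective]
  rfl

variable [IsProbabilityMeasure P]

/-- Centred independent variables of unit variance are orthonormal in `L²`. -/
lemma eLpNorm_two_sum_mul (hν : MemLp (fun x : ℝ => x) 2 ν) (hν_mean : ∫ x, x ∂ν = 0)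
    (hν_var : ∫ x, x ^ 2 ∂ν = 1) (hW : iIndepFun W P) (hlaw : ∀ k, HasLaw (W k) ν P)
    (c : ℕ → ℝ) (s : Finset ℕ) :
    eLpNorm (fun ω => ∑ k ∈ s, c k * W k ω) 2 P = ENNReal.ofReal √(∑ k ∈ s, c k ^ 2) := by
  have hL := memLp_two_of_hasLaw hν hlaw
  have hLc : ∀ k, MemLp (fun ω => c k * W k ω) 2 P := fun k => (hL k).const_mul _
  have hmean : ∀ k, ∫ ω, W k ω ∂P = 0 := fun k => by rw [(hlaw k).integral_eq, hν_mean]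
  have hvar : ∀ k, Var[W k; P] = 1 := fun k => by
    rw [(hlaw k).variance_eq, variance_of_integral_eq_zero aemeasurable_id hν_mean]
    exact hν_var
  have hS : MemLp (fun ω => ∑ k ∈ s, c k * W k ω) 2 P := memLp_finsetSum s fun k _ => hLc k
  have hmeanS : ∫ ω, ∑ k ∈ s, c k * W k ω ∂P = 0 := by
    rw [integral_finsetSum _ fun k _ => (hLc k).integrable (by norm_num)]
    simp [integral_const_mul, hmean]
  have hi : iIndepFun (fun k ω => c k * W k ω) P :=
    hW.comp (fun k x => c k * x) fun k => by fun_prop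
  have hv : ∫ ω, (∑ k ∈ s, c k * W k ω) ^ 2 ∂P = ∑ k ∈ s, c k ^ 2 := by
    rw [← variance_of_integral_eq_zero hS.aemeasurable hmeanS]
    have := IndepFun.variance_sum (X := fun k ω => c k * W k ω) (s := s) (μ := P)
      (fun k _ => hLc k) fun i _ j _ hij => hi.indepFun hij
    have e : (fun ω => ∑ k ∈ s, c k * W k ω) = ∑ k ∈ s, fun ω => c k * W k ω := by
      ext ω; simp
    rw [e, this]
    simp [variance_const_mul, hvar]
  rw [hS.eLpNorm_eq_integral_rpow_norm (by norm_num) (by norm_num), Real.sqrt_eq_rpow, ← hv]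
  simp

lemma tendsto_charFun_map (hW : iIndepFun W P) (hlaw : ∀ k, HasLaw (W k) ν P) {c : ℕ → ℝ}
    {X : Ω → ℝ} (hX : IsL2Series P c W X) (t : ℝ) :
    Tendsto (fun N => ∏ k ∈ Finset.range N, charFun ν (c k * t)) atTop
      (𝓝 (charFun (P.map X) t)) := by
  rw [tendsto_iff_norm_sub_tendsto_zero]
  have hfin : ∀ᶠ N in atTop,
      eLpNorm (fun ω => X ω - ∑ k ∈ Finset.range N, c k * W k ω) 2 P < 1 :=
    hX.2.eventually_lt_const one_pos
  have hlim := (ENNReal.tendsto_toReal ENNReal.zero_ne_top).comp hX.2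
  refine squeeze_zero' (.of_forall fun _ => norm_nonneg _) ?_
    (by simpa using hlim.const_mul |t|)
  filter_upwards [hfin] with N hN
  rw [← charFun_map_sum_mul hW hlaw, norm_sub_rev]
  exact norm_charFun_map_sub_le hX.1.aemeasurable
    (Finset.aemeasurable_fun_sum _ fun k _ => (hlaw k).aemeasurable.const_mul _)
    (hN.trans ENNReal.one_lt_top).ne t

/-- The cumulants of order at least two of `∑ c k * W k` are those of the common law multiplied by
the power sums of the coefficients. -/
lemma cumulant_map_of_isL2Series [IsProbabilityMeasure ν]
    (hν_mom : ∀ p : ℕ, MemLp (fun x : ℝ => x) (p : ℝ≥0∞) ν)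
    (hν_mean : ∫ x, x ∂ν = 0) (hW : iIndepFun W P) (hlaw : ∀ k, HasLaw (W k) ν P) {c : ℕ → ℝ}
    (hc : HasSum (fun k => c k ^ 2) 1) {X : Ω → ℝ} (hX : IsL2Series P c W X) (j : ℕ) :
    cumulant (j + 2) (P.map X) = (∑' k, c k ^ (j + 2)) * cumulant (j + 2) ν := by
  have hφ : ContDiff ℝ (⊤ : ℕ∞) (charFun ν) := contDiff_charFun' hν_mom
  have hφ0 : charFun ν 0 = 1 := by simp
  set U : Set ℝ := charFun ν ⁻¹' Complex.slitPlane with hUdef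
  have hU : IsOpen U := Complex.isOpen_slitPlane.preimage hφ.continuous
  have h0U : (0 : ℝ) ∈ U := by simp [hUdef]
  set f : ℝ → ℂ := fun t => Complex.log (charFun ν t) with hfdef
  have hf : ContDiffOn ℝ (⊤ : ℕ∞) f U := fun t ht =>
    ((Complex.contDiffAt_log ht).restrict_scalars ℝ |>.comp t hφ.contDiffAt).contDiffWithinAt
  have hf0 : f 0 = 0 := by simp [hfdef]
  -- The mean is zero; without this, square-summability of `c` would not make `∑ f (c k * t)`
  -- converge.
  have hf1 : deriv f 0 = 0 := by
    have hd : deriv (charFun ν) 0 = 0 := by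
      have := iteratedDeriv_charFun_zero (μ := ν) (n := 1) (hν_mom 1)
      rw [iteratedDeriv_one] at this
      rw [this]
      simp [hν_mean]
    have h := (hφ.differentiable (by simp)).differentiableAt (x := 0) |>.hasDerivAt.clog_real h0U
    rw [h.deriv, hd, zero_div]
  obtain ⟨δ, hδ, hball⟩ := Metric.nhds_basis_closedBall.mem_iff.1 (hU.mem_nhds h0U)
  have hδU : Set.Icc (-δ) δ ⊆ U := by
    rwa [Real.closedBall_eq_Icc, zero_sub, zero_add] at hball
  have h0δ : (0 : ℝ) ∈ Set.Ioo (-δ) δ := by simpa using hδ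
  have hc1 := abs_le_one_of_hasSum_sq hc
  have hexp : ∀ t ∈ Set.Ioo (-δ) δ, charFun (P.map X) t = Complex.exp (∑' k, f (c k * t)) := by
    intro t ht
    refine tendsto_nhds_unique (tendsto_charFun_map hW hlaw hX t) ?_
    have hs := (summable_comp_mul hU hf hδU hf0 hf1 hc ht).hasSum.tendsto_sum_nat
    refine ((Complex.continuous_exp.tendsto _).comp hs).congr fun N => ?_
    rw [Function.comp_apply, Complex.exp_sum]
    refine Finset.prod_congr rfl fun k _ => Complex.exp_log (Complex.slitPlane_ne_zero (hδU ?_))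
    rw [Set.mem_Icc, ← abs_le, abs_mul]
    exact (mul_le_of_le_one_left (abs_nonneg _) (hc1 k)).trans (abs_lt.2 ht).le
  have hcont : ContinuousAt (fun t => ∑' k, f (c k * t)) 0 := by
    have := (hasDerivAt_tsum_pow_smul_iteratedDeriv hU hf hδ hδU hf0 hf1 hc 0 h0δ).continuousAt
    simpa using this
  -- Near `0` the sum stays in the strip where the principal logarithm inverts `exp`.
  have him : ∀ᶠ t in 𝓝 (0 : ℝ), ‖∑' k, f (c k * t)‖ < Real.pi := by
    refine hcont.norm.eventually_lt_const ?_
    simpa [hf0] using Real.pi_pos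
  have heq : (fun t => Complex.log (charFun (P.map X) t)) =ᶠ[𝓝 0] fun t => ∑' k, f (c k * t) := by
    filter_upwards [him, isOpen_Ioo.mem_nhds h0δ] with t ht ht'
    have hlt := abs_lt.1 ((Complex.abs_im_le_norm _).trans_lt ht)
    rw [hexp t ht', Complex.log_exp hlt.1 hlt.2.le]
  unfold cumulant
  rw [heq.iteratedDeriv_eq, iteratedDeriv_tsum_comp_mul hU hf hδ hδU hf0 hf1 hc _ h0δ]
  simp only [mul_zero]
  rw [tsum_mul_right]
  have : ∑' k, (c k ^ (j + 2) : ℂ) = ((∑' k, c k ^ (j + 2) : ℝ) : ℂ) := by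
    rw [Complex.ofReal_tsum]; simp
  rw [this, mul_left_comm, Complex.re_ofReal_mul]

end Series

/-! ### Couplings and copies of the target -/

lemma wassersteinDist_two_map_le {Ω : Type*} [MeasurableSpace Ω] {P : Measure Ω} {X Y : Ω → ℝ}
    (hX : AEMeasurable X P) (hY : AEMeasurable Y P) :
    wassersteinDist 2 (P.map X) (P.map Y) ≤ eLpNorm (fun ω => X ω - Y ω) 2 P := by
  have hXY := hX.prodMk hY
  refine iInf₂_le_of_le (P.map fun ω => (X ω, Y ω)) ⟨?_, ?_⟩ (le_of_eq ?_)
  · rw [AEMeasurable.map_map_of_aemeasurable measurable_fst.aemeasurable hXY]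
    rfl
  · rw [AEMeasurable.map_map_of_aemeasurable measurable_snd.aemeasurable hXY]
    rfl
  · have hm : Measurable fun z : ℝ × ℝ => ENNReal.ofReal |z.1 - z.2| ^ (2 : ℝ) := by fun_prop
    rw [lintegral_map' hm.aemeasurable hXY,
      eLpNorm_eq_lintegral_rpow_enorm_toReal (by norm_num) (by norm_num)]
    simp [Real.enorm_eq_ofReal_abs]

lemma sum_range_eq_sum_comp_of_support {q : ℕ} {σ : Fin q → ℕ} (hσ : Function.Injective σ)
    {h : ℕ → ℝ} (h0 : ∀ k, k ∉ Set.range σ → h k = 0) {N : ℕ} (hN : ∀ s, σ s < N) :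
    ∑ k ∈ Finset.range N, h k = ∑ s, h (σ s) := by
  rw [← Finset.sum_image (s := Finset.univ) (f := h) hσ.injOn]
  refine (Finset.sum_subset (fun k hk => ?_) fun k _ hk => h0 k (by simpa using hk)).symm
  obtain ⟨s, -, rfl⟩ := Finset.mem_image.1 hk
  exact Finset.mem_range.2 (hN s)

lemma hasSum_extend_pow {q : ℕ} (a : Fin q → ℝ) (j : ℕ) :
    HasSum (fun k => Function.extend Fin.val a 0 k ^ (j + 2)) (∑ s, a s ^ (j + 2)) := by
  have h0 : ∀ k, k ∉ Set.range (Fin.val : Fin q → ℕ) →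
      Function.extend Fin.val a 0 k ^ (j + 2) = 0 := fun k hk => by
    rw [Function.extend_apply' _ _ _ hk]
    simp
  have h := hasSum_sum_of_ne_finset_zero (s := Finset.range q) (L := .unconditional ℕ)
    (f := fun k => Function.extend Fin.val a 0 k ^ (j + 2))
    fun k hk => h0 k (by rintro ⟨s, rfl⟩; exact hk (Finset.mem_range.2 s.2))
  rw [sum_range_eq_sum_comp_of_support Fin.val_injective h0 fun s => s.2] at h
  simpa [Fin.val_injective.extend_apply] using h

section Series

variable {Ω : Type*} [MeasurableSpace Ω] {P : Measure Ω} {ν : Measure ℝ} {W : ℕ → Ω → ℝ}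

lemma memLp_targetSum (hν : MemLp (fun x : ℝ => x) 2 ν) (hlaw : ∀ k, HasLaw (W k) ν P) {q : ℕ}
    (a : Fin q → ℝ) : MemLp (targetSum a W) 2 P :=
  memLp_finsetSum _ fun k _ => (memLp_two_of_hasLaw hν hlaw k).const_mul _

lemma isL2Series_targetSum (hν : MemLp (fun x : ℝ => x) 2 ν) (hlaw : ∀ k, HasLaw (W k) ν P)
    {q : ℕ} (a : Fin q → ℝ) :
    IsL2Series P (Function.extend Fin.val a 0) W (targetSum a W) := by
  refine ⟨memLp_targetSum hν hlaw a, tendsto_const_nhds.congr' ?_⟩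
  filter_upwards [eventually_ge_atTop q] with N hN
  have : ∀ ω, ∑ k ∈ Finset.range N, Function.extend Fin.val a 0 k * W k ω = targetSum a W ω := by
    intro ω
    rw [sum_range_eq_sum_comp_of_support Fin.val_injective (fun k hk => ?_)
      fun s => s.2.trans_le hN]
    · simp [Fin.val_injective.extend_apply, targetSum]
    · rw [Function.extend_apply' _ _ _ hk]
      simp
  simp [this]

variable [IsProbabilityMeasure P]

/-- The target is itself an `L²` series, with `a` extended by zeros, so one cumulant formula covers
both laws. The factors `|cumulant (j + 2) ν|` become the weights in `exists_matching`. -/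
lemma cumulantGap_eq [IsProbabilityMeasure ν]
    (hν_mom : ∀ p : ℕ, MemLp (fun x : ℝ => x) (p : ℝ≥0∞) ν)
    (hν_mean : ∫ x, x ∂ν = 0) (hW : iIndepFun W P) (hlaw : ∀ k, HasLaw (W k) ν P) {q : ℕ}
    {a : Fin q → ℝ} (ha_norm : ∑ k, a k ^ 2 = 1) {c : ℕ → ℝ}
    (hc : HasSum (fun k => c k ^ 2) 1) {X : Ω → ℝ} (hX : IsL2Series P c W X) :
    cumulantGap q (P.map X) (P.map (targetSum a W)) = ∑ j ∈ Finset.range q,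
      |cumulant (j + 2) ν| * |∑' k, c k ^ (j + 2) - ∑ t, a t ^ (j + 2)| := by
  have hT := isL2Series_targetSum (hν_mom 2) hlaw a
  have hcT : HasSum (fun k => Function.extend Fin.val a 0 k ^ 2) 1 := by
    simpa [ha_norm] using hasSum_extend_pow a 0
  have hIcc : Finset.Icc 2 (q + 1) = Finset.Ico (0 + 2) (q + 2) := by ext; simp; omega
  rw [cumulantGap, hIcc, ← Finset.sum_Ico_add', ← Finset.range_eq_Ico]
  refine Finset.sum_congr rfl fun j _ => ?_
  rw [cumulant_map_of_isL2Series hν_mom hν_mean hW hlaw hc hX,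
    cumulant_map_of_isL2Series hν_mom hν_mean hW hlaw hcT hT, (hasSum_extend_pow a j).tsum_eq,
    ← sub_mul, abs_mul, mul_comm]

/-- If the coefficients of a series match, up to a permutation and an `ℓ²` error `B`, those of the
target, then the series is within `L²` distance `B` of a copy of the target. -/
lemma exists_copy_of_matching (hν : MemLp (fun x : ℝ => x) 2 ν) (hν_mean : ∫ x, x ∂ν = 0)
    (hν_var : ∫ x, x ^ 2 ∂ν = 1) (hW : iIndepFun W P) (hlaw : ∀ k, HasLaw (W k) ν P) {q : ℕ}
    {a : Fin q → ℝ} {c c' : ℕ → ℝ} {X : Ω → ℝ} (hX : IsL2Series P c W X)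
    {σ : Fin q → ℕ} (hσ : Function.Injective σ) (hσa : ∀ s, c' (σ s) = a s)
    (hσ0 : ∀ k, k ∉ Set.range σ → c' k = 0) {B : ℝ}
    (hB : ∀ N, √(∑ k ∈ Finset.range N, (c k - c' k) ^ 2) ≤ B) :
    ∃ Y : Ω → ℝ, AEMeasurable Y P ∧ P.map Y = P.map (targetSum a W) ∧
      eLpNorm (fun ω => X ω - Y ω) 2 P ≤ ENNReal.ofReal B := by
  have hWL := memLp_two_of_hasLaw hν hlaw
  have hY : AEMeasurable (fun ω => ∑ s, a s * W (σ s) ω) P :=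
    Finset.aemeasurable_fun_sum _ fun s _ => (hlaw _).aemeasurable.const_mul _
  refine ⟨fun ω => ∑ s, a s * W (σ s) ω, hY, map_sum_mul_comp_eq hW hlaw a hσ, ?_⟩
  -- The series is compared through its truncations, whose error tends to zero.
  refine ge_of_tendsto (x := atTop) (f := fun N =>
    eLpNorm (fun ω => X ω - ∑ k ∈ Finset.range N, c k * W k ω) 2 P + ENNReal.ofReal B)
    (by simpa using hX.2.add_const (ENNReal.ofReal B)) ?_
  -- Beyond `∑ s, σ s` the truncation contains every index carrying a non-zero `c' k`.
  filter_upwards [eventually_gt_atTop (∑ s, σ s)] with N hN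
  have hlt : ∀ s, σ s < N := fun s =>
    (Finset.single_le_sum (f := σ) (fun _ _ => Nat.zero_le _) (Finset.mem_univ s)).trans_lt hN
  have hsum : ∀ ω, ∑ k ∈ Finset.range N, c' k * W k ω = ∑ s, a s * W (σ s) ω := fun ω => by
    rw [sum_range_eq_sum_comp_of_support hσ (fun k hk => by rw [hσ0 k hk, zero_mul]) hlt]
    simp [hσa]
  have hsplit : (fun ω => X ω - ∑ s, a s * W (σ s) ω) =
      (fun ω => X ω - ∑ k ∈ Finset.range N, c k * W k ω) +
        fun ω => ∑ k ∈ Finset.range N, (c k - c' k) * W k ω := by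
    ext ω
    simp only [Pi.add_apply, sub_mul, Finset.sum_sub_distrib, hsum]
    ring
  have hS : ∀ d : ℕ → ℝ, MemLp (fun ω => ∑ k ∈ Finset.range N, d k * W k ω) 2 P := fun d =>
    memLp_finsetSum _ fun k _ => (hWL k).const_mul _
  rw [hsplit]
  refine (eLpNorm_add_le (hX.1.sub (hS c)).1 (hS _).1 (by norm_num)).trans (add_le_add le_rfl ?_)
  rw [eLpNorm_two_sum_mul hν hν_mean hν_var hW hlaw]
  exact ENNReal.ofReal_le_ofReal (hB N)

lemma eLpNorm_two_le_one_of_isL2Series (hν : MemLp (fun x : ℝ => x) 2 ν)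
    (hν_mean : ∫ x, x ∂ν = 0) (hν_var : ∫ x, x ^ 2 ∂ν = 1) (hW : iIndepFun W P)
    (hlaw : ∀ k, HasLaw (W k) ν P) {c : ℕ → ℝ} (hc : HasSum (fun k => c k ^ 2) 1) {X : Ω → ℝ}
    (hX : IsL2Series P c W X) : eLpNorm X 2 P ≤ 1 := by
  have hWL := memLp_two_of_hasLaw hν hlaw
  refine ge_of_tendsto (x := atTop) (f := fun N =>
    eLpNorm (fun ω => X ω - ∑ k ∈ Finset.range N, c k * W k ω) 2 P + 1)
    (by simpa using hX.2.add_const 1) (.of_forall fun N => ?_)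
  have hS : MemLp (fun ω => ∑ k ∈ Finset.range N, c k * W k ω) 2 P :=
    memLp_finsetSum _ fun k _ => (hWL k).const_mul _
  have hsplit : X = (fun ω => X ω - ∑ k ∈ Finset.range N, c k * W k ω) +
      fun ω => ∑ k ∈ Finset.range N, c k * W k ω := by
    ext ω; simp
  calc eLpNorm X 2 P = eLpNorm ((fun ω => X ω - ∑ k ∈ Finset.range N, c k * W k ω) +
      fun ω => ∑ k ∈ Finset.range N, c k * W k ω) 2 P := by rw [← hsplit]
    _ ≤ _ := eLpNorm_add_le (hX.1.sub hS).1 hS.1 (by norm_num)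
    _ ≤ _ := by
      refine add_le_add le_rfl ?_
      rw [eLpNorm_two_sum_mul hν hν_mean hν_var hW hlaw, ENNReal.ofReal_le_one,
        Real.sqrt_le_one]
      exact sum_le_hasSum _ (fun _ _ => sq_nonneg _) hc

end Series

/-! ### The quantitative bounds and convergence in distribution -/

theorem theorem3p3
    -- the target: `q`, the coefficients `a` and the common law `ν` of the `W k`
    (q : ℕ) (hq : 2 ≤ q) (a : Fin q → ℝ)
    (ha_ne : ∀ k, a k ≠ 0) (ha_inj : Function.Injective a) (ha_norm : ∑ k, a k ^ 2 = 1)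
    (ν : Measure ℝ) [IsProbabilityMeasure ν]
    (hν_mom : ∀ p : ℕ, MemLp (fun x : ℝ => x) (p : ℝ≥0∞) ν)
    (hν_mean : ∫ x, x ∂ν = 0) (hν_var : ∫ x, x ^ 2 ∂ν = 1)
    (hν_cum : ∀ r ∈ Finset.Icc 2 (q + 1), cumulant r ν ≠ 0) :
    ∃ C : ℝ, 0 < C ∧ ∃ U : ℝ, 0 < U ∧
      ∀ (Ω : Type*) [MeasurableSpace Ω] (P : Measure Ω) [IsProbabilityMeasure P]
        (W : ℕ → Ω → ℝ) (_ : iIndepFun W P) (_ : ∀ k, HasLaw (W k) ν P)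
        (α : ℕ → ℕ → ℝ) (_ : ∀ n, HasSum (fun k => α n k ^ 2) 1)
        (F : ℕ → Ω → ℝ) (_ : ∀ n, IsL2Series P (α n) W (F n)),
        (∀ n, wassersteinDist 2 (P.map (F n)) (P.map (targetSum a W)) ≤
          ENNReal.ofReal (C * (√(steinDelta a (α n)) +
            cumulantGap q (P.map (F n)) (P.map (targetSum a W))))) ∧
        (∀ n, √(steinDelta a (α n)) +
            cumulantGap q (P.map (F n)) (P.map (targetSum a W)) ≤ U →
          wassersteinDist 2 (P.map (F n)) (P.map (targetSum a W)) ≤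
            ENNReal.ofReal (C * √(steinDelta a (α n)))) ∧
        (Tendsto (fun n => steinDelta a (α n)) atTop (𝓝 0) →
          (∀ r ∈ Finset.Icc 2 (q + 1), Tendsto (fun n => cumulant r (P.map (F n))) atTop
            (𝓝 (cumulant r (P.map (targetSum a W))))) →
          (∀ᶠ n in atTop, √(steinDelta a (α n)) +
              cumulantGap q (P.map (F n)) (P.map (targetSum a W)) ≤ U ∧
            wassersteinDist 2 (P.map (F n)) (P.map (targetSum a W)) ≤
              ENNReal.ofReal (C * √(steinDelta a (α n)))) ∧
          TendstoInDistribution F atTop (targetSum a W) (fun _ => P) P) := by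
  obtain ⟨K, hK, U, hU, hmatch⟩ := exists_matching a ha_ne ha_inj (fun j => |cumulant (j + 2) ν|)
    fun j hj => abs_pos.2 (hν_cum _ (Finset.mem_Icc.2 ⟨by omega, by omega⟩))
  have hν : MemLp (fun x : ℝ => x) 2 ν := hν_mom 2
  -- `K` serves below the threshold `U`; above it, `2 / U` absorbs the bound `2` given by two
  -- variables of `L²` norm at most `1`.
  refine ⟨K + 2 / U, by positivity, U, hU, ?_⟩
  intro Ω _ P _ W hW hlaw α hα F hF
  have hT := memLp_targetSum hν hlaw a
  have hcopy : ∀ n, √(steinDelta a (α n)) +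
      cumulantGap q (P.map (F n)) (P.map (targetSum a W)) ≤ U →
      ∃ Y : Ω → ℝ, AEMeasurable Y P ∧ P.map Y = P.map (targetSum a W) ∧
        eLpNorm (fun ω => F n ω - Y ω) 2 P ≤ ENNReal.ofReal (K * √(steinDelta a (α n))) := by
    intro n hn
    rw [cumulantGap_eq hν_mom hν_mean hW hlaw ha_norm (hα n) (hF n)] at hn
    obtain ⟨σ, c', hσ, hσa, hσ0, hB⟩ := hmatch (α n) (hα n) hn
    exact exists_copy_of_matching hν hν_mean hν_var hW hlaw (hF n) hσ hσa hσ0 hB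
  have hgap0 : ∀ n, 0 ≤ cumulantGap q (P.map (F n)) (P.map (targetSum a W)) := fun n =>
    Finset.sum_nonneg fun _ _ => abs_nonneg _
  have hsmall : ∀ n, √(steinDelta a (α n)) +
      cumulantGap q (P.map (F n)) (P.map (targetSum a W)) ≤ U →
      wassersteinDist 2 (P.map (F n)) (P.map (targetSum a W)) ≤
        ENNReal.ofReal ((K + 2 / U) * √(steinDelta a (α n))) := by
    intro n hn
    obtain ⟨Y, hY, hYlaw, hYle⟩ := hcopy n hn
    rw [← hYlaw]
    refine (wassersteinDist_two_map_le (hF n).1.aemeasurable hY).trans (hYle.trans ?_)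
    refine ENNReal.ofReal_le_ofReal (mul_le_mul_of_nonneg_right ?_ (Real.sqrt_nonneg _))
    linarith [div_pos two_pos hU]
  refine ⟨fun n => ?_, hsmall, fun hΔ hκ => ?_⟩
  · rcases le_or_gt (√(steinDelta a (α n)) +
      cumulantGap q (P.map (F n)) (P.map (targetSum a W))) U with hn | hn
    · refine (hsmall n hn).trans (ENNReal.ofReal_le_ofReal ?_)
      exact mul_le_mul_of_nonneg_left (by linarith [hgap0 n]) (by positivity)
    · have hcT : HasSum (fun k => Function.extend Fin.val a 0 k ^ 2) 1 := by
        simpa [ha_norm] using hasSum_extend_pow a 0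
      have h1 := eLpNorm_two_le_one_of_isL2Series hν hν_mean hν_var hW hlaw (hα n) (hF n)
      have h2 := eLpNorm_two_le_one_of_isL2Series hν hν_mean hν_var hW hlaw hcT
        (isL2Series_targetSum hν hlaw a)
      refine (wassersteinDist_two_map_le (hF n).1.aemeasurable hT.aemeasurable).trans
        ((eLpNorm_sub_le (hF n).1.1 hT.1 (by norm_num)).trans ((add_le_add h1 h2).trans ?_))
      rw [one_add_one_eq_two, ← ENNReal.ofReal_ofNat 2]
      refine ENNReal.ofReal_le_ofReal ?_
      have h3 : 2 / U * U ≤ (K + 2 / U) * (√(steinDelta a (α n)) +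
          cumulantGap q (P.map (F n)) (P.map (targetSum a W))) :=
        mul_le_mul (by linarith) hn.le hU.le (by positivity)
      rwa [div_mul_cancel₀ _ hU.ne'] at h3
  · have hsqrt : Tendsto (fun n => √(steinDelta a (α n))) atTop (𝓝 0) := by
      simpa using hΔ.sqrt
    have hgap : Tendsto (fun n => cumulantGap q (P.map (F n)) (P.map (targetSum a W))) atTop
        (𝓝 0) := by
      have := tendsto_finsetSum (Finset.Icc 2 (q + 1)) fun r hr =>
        ((hκ r hr).sub_const (cumulant r (P.map (targetSum a W)))).abs
      simpa [cumulantGap] using this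
    have hev : ∀ᶠ n in atTop, √(steinDelta a (α n)) +
        cumulantGap q (P.map (F n)) (P.map (targetSum a W)) ≤ U :=
      (by simpa using hsqrt.add hgap : Tendsto (fun n => √(steinDelta a (α n)) +
        cumulantGap q (P.map (F n)) (P.map (targetSum a W))) atTop (𝓝 0)).eventually_le_const hU
    refine ⟨hev.mono fun n hn => ⟨hn, hsmall n hn⟩, fun n => (hF n).1.aemeasurable,
      hT.aemeasurable, ?_⟩
    refine ProbabilityMeasure.tendsto_of_tendsto_charFun fun t => ?_
    rw [tendsto_iff_norm_sub_tendsto_zero]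
    refine squeeze_zero' (.of_forall fun _ => norm_nonneg _) ?_
      (by simpa using (hsqrt.const_mul K).const_mul |t|)
    filter_upwards [hev] with n hn
    -- The copy `Y` depends on `n` but its law does not, so it may replace the target in the
    -- characteristic function.
    obtain ⟨Y, hY, hYlaw, hYle⟩ := hcopy n hn
    simp only [ProbabilityMeasure.coe_mk]
    rw [← hYlaw]
    refine (norm_charFun_map_sub_le (hF n).1.aemeasurable hY
      (hYle.trans_lt ENNReal.ofReal_lt_top).ne t).trans ?_
    refine mul_le_mul_of_nonneg_left ?_ (abs_nonneg t)
    exact ENNReal.toReal_le_of_le_ofReal (by positivity) hYle
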